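/- Let $n,q\ge 0$ and let $w=w_1w_2\cdots w_n$ be a word of length $n$ in the alphabet $\{1,\dots,q\}$. Then $$K\text{-}\mathtt{infusion}_1(S,T_w)=P(w),$$ as tableaux (same shape, same labels), where the objects are as follows. *The tableaux $S$ and $T_w$.* Let $\gamma_m=(m,m-1,\dots,2,1)$ be the staircase shape (English notation; $\gamma_m=\emptyset$ for $m\le 0$). $S$ is the superstandard Young tableau of shape $\gamma_{n-1}$: its first row is $1,2,\dots,n-1$, its second row is $n,n+1,\dots,2n-3$, and so on. $T_w$ is the tableau of skew shape $\gamma_n/\gamma_{n-1}$ ($n$ single boxes along an antidiagonal) in which $w_1,\dots,w_n$ are arranged from southwest to northeast. *$K$-infusion.* Let $A$ be an increasing tableau of straight shape $\mu$ with maximum entry $p$, and $B$ an increasing tableau of skew shape $\nu/\mu$ with maximum entry $r$ (the maximum entry of an empty tableau is $0$). Fill $\nu$ by the entries of $A$, which are underlined, and those of $B$, which are not. A filling of $\nu$ by labels of these two alphabets is a mixed tableau if no label of either alphabet occurs twice in a row or in a column. For a mixed tableau $M$, $\mathtt{switch}(\underline i,j)(M)$ is obtained by interchanging the labels $\underline i$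 and $j$ in each non-singleton connected component (boxes being adjacent if they share an edge) of the set of boxes with entry $\underline i$ or $j$; if the result is not a mixed tableau, it is replaced by the null tableau, which all switches fix. Apply the switches indexed by $$(\underline p,1),\dots,(\underline p,r),(\underline{p-1},1),\dots,(\underline{p-1},r),\dots,(\underline 1,1),\dots,(\underline 1,r)$$ in this order, from left to right. $K\text{-}\mathtt{infusion}_1(A,B)$ is the part of the result formed by the boxes with labels that are not underlined. (The assertion includes that for $A=S$, $B=T_w$ the result is not the null tableau.) *Hecke insertion.* $P(w)=((\emptyset\leftarrow w_1)\leftarrow w_2)\leftarrow\cdots\leftarrow w_n$ is the insertion tableau of $\mathtt{Hecke}(w)$, where $T\leftarrow x$ is computed by inserting $x$ into the first row of the increasing tableau $T$ according to this rule. To insert $x$ into a row $R$ (possibly the empty row below the last one): if $R$ has entries larger than $x$, let $y$ be the smallest of them; replace $y$ by $x$ if this results in an increasing tableau (rows and columns strictly increasing), and otherwise leave the tableau unchanged; in either case insert $y$ into the next row. If $x$ is larger than or equal to all entries of $R$, adjoin $x$ to the end of $R$ if this results in an increasing tableau, otherwise leave the tableau unchanged; then stop. -/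

import Mathlib

/-!
Boxes are pairs `(row, column)` of natural numbers, counted from `0` in English notation
(rows go down, columns go right).
-/

namespace KTab

/-- A partial filling of the boxes of the plane by numbers; `none` means that the box
does not belong to the shape.  Two fillings are equal exactly when they have the same shape and
the same labels. -/
abbrev Filling : Type := ℕ × ℕ → Option ℕ

/-- The set of words of length `n` in the alphabet `{1, …, q}`. -/
def Words (n q : ℕ) : Set (Fin n → ℕ) := {w | ∀ k, 1 ≤ w k ∧ w k ≤ q}

/-! ### Hecke insertion -/

/-- A list of rows, from top to bottom, is an increasing tableau (of straight shape):
the rows are nonempty and of weakly decreasing length, and labels increase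
strictly along rows and down columns. -/
def IsIncreasing (T : List (List ℕ)) : Prop :=
  (∀ r ∈ T, r ≠ [] ∧ r.Pairwise (· < ·)) ∧
    T.IsChain fun r s => s.length ≤ r.length ∧ ∀ e ∈ r.zip s, e.1 < e.2

instance (T : List (List ℕ)) : Decidable (IsIncreasing T) := by
  unfold IsIncreasing
  infer_instance

/-- The row of `T` with index `i`; it is empty if `T` has no such row. -/
def row (T : List (List ℕ)) (i : ℕ) : List ℕ := T.getD i []

/-- Adjoin `x` to the end of the row of `T` with index `i`, starting a new row if `T` has
exactly `i` rows. -/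
def adjoin (T : List (List ℕ)) (i x : ℕ) : List (List ℕ) :=
  if i < T.length then T.set i (row T i ++ [x]) else T ++ [[x]]

/-- Insert `x` into the row of `T` with index `i`, and continue downwards.
If the row contains a label larger than `x`, let `y` be the smallest such label (in an
increasing tableau it is the first one); replace `y` by `x` if the result is an increasing
tableau; in either case insert `y` into the next row.
Otherwise adjoin `x` to the end of the row if the result is an increasing
tableau, and stop. -/
def heckeInsertRow (T : List (List ℕ)) (i x : ℕ) : List (List ℕ) :=
  let j := (row T i).findIdx (fun y => decide (x < y))
  if hj : j < (row T i).length then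
    let T' := T.set i ((row T i).set j x)
    heckeInsertRow (if IsIncreasing T' then T' else T) (i + 1) (row T i)[j]
  else if IsIncreasing (adjoin T i x) then adjoin T i x
  else T
termination_by T.length - i
decreasing_by
  have hi : i < T.length := by
    by_contra hi
    have h0 : row T i = [] := by simp [row, List.getD, not_lt.mp hi]
    simp [h0] at hj
  split_ifs <;> simp <;> omega

/-- `T ← x`. -/
def heckeInsert (T : List (List ℕ)) (x : ℕ) : List (List ℕ) := heckeInsertRow T 0 x

/-- The insertion tableau `(((∅ ← w₁) ← w₂) ← ⋯) ← wₙ` of a word, as a list of rows. -/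
def heckeRows {n : ℕ} (w : Fin n → ℕ) : List (List ℕ) := (List.ofFn w).foldl heckeInsert []

/-- The filling of the plane given by a list of rows. -/
def ofRows (T : List (List ℕ)) : Filling := fun c => (row T c.1)[c.2]?

/-- The insertion tableau of a word. -/
def heckeTableau {n : ℕ} (w : Fin n → ℕ) : Filling := ofRows (heckeRows w)

/-! ### Switches and `K`-infusion -/

/-- Fillings of the plane by labels from two alphabets: `Sum.inl i` is the underlined
label `i`, and `Sum.inr j` is the label `j` that is not underlined. -/
abbrev MixedFilling : Type := ℕ × ℕ → Option (ℕ ⊕ ℕ)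

/-- A mixed tableau: no label (of either alphabet) occurs twice in a row or in a column. -/
def IsMixed (M : MixedFilling) : Prop :=
  ∀ c d : ℕ × ℕ, c ≠ d → (c.1 = d.1 ∨ c.2 = d.2) → ∀ a, M c = some a → M d ≠ some a

/-- Two boxes are adjacent when they share an edge. -/
def boxGraph : SimpleGraph (ℕ × ℕ) :=
  SimpleGraph.fromRel fun c d =>
    (c.1 = d.1 ∧ c.2 + 1 = d.2) ∨ (c.1 + 1 = d.1 ∧ c.2 = d.2)

/-- The boxes whose entry is the underlined label `i` or the plain label `j`. -/
def switchBoxes (i j : ℕ) (M : MixedFilling) : Set (ℕ × ℕ) :=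
  {c | M c = some (Sum.inl i) ∨ M c = some (Sum.inr j)}

/-- The connected component of the box `c` in the set of boxes `B` is not a single box. -/
def InNonsingletonComponent (B : Set (ℕ × ℕ)) (c : ℕ × ℕ) : Prop :=
  ∃ h : c ∈ B, ((boxGraph.induce B).connectedComponentMk ⟨c, h⟩).supp.Nontrivial

open Classical in
/-- Interchange the underlined `i`'s and the plain `j`'s on every non-singleton
connected component of the set of boxes that they occupy. -/
noncomputable def interchange (i j : ℕ) (M : MixedFilling) : MixedFilling := fun c =>
  if InNonsingletonComponent (switchBoxes i j M) c then
    if M c = some (Sum.inl i) then some (Sum.inr j) else some (Sum.inl i)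
  else M c

open Classical in
/-- The operator `switch(i, j)`, with `i` underlined.  The value `none` is the null tableau:
it is the result if the interchange does not give a mixed tableau, and it is fixed. -/
noncomputable def switch (i j : ℕ) : Option MixedFilling → Option MixedFilling
  | none => none
  | some M => if IsMixed (interchange i j M) then some (interchange i j M) else none

/-- The sequence `(p,1), (p,2), …, (p,q), (p-1,1), …, (p-1,q), …, (1,1), …, (1,q)`. -/
def standardSwitchSequence (p q : ℕ) : List (ℕ × ℕ) :=
  (List.range' 1 p).reverse.flatMap fun i => (List.range' 1 q).map fun j => (i, j)

/-- The maximum entry of a tableau (`0` for the empty tableau). -/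
noncomputable def maxEntry (A : Filling) : ℕ := sSup {a | ∃ c, A c = some a}

/-- The tableau `B` of skew shape `ν/μ` together with the tableau `A` of shape `μ`, whose
entries are underlined. -/
def overlay (A B : Filling) : MixedFilling := fun c =>
  match A c with
  | some a => some (Sum.inl a)
  | none => (B c).map Sum.inr

/-- The result of applying the standard switch sequence, from left to right, to `A` and `B`. -/
noncomputable def switchAll (A B : Filling) : Option MixedFilling :=
  (standardSwitchSequence (maxEntry A) (maxEntry B)).foldl
    (fun M ij => switch ij.1 ij.2 M) (some (overlay A B))

/-- The part of a mixed filling that is not underlined. -/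
def plainPart (M : MixedFilling) : Filling := fun c => (M c).bind Sum.getRight?

/-- The first component `K`-infusion₁(A, B) of the `K`-infusion of `A` and `B`
(`none` if the null tableau arises). -/
noncomputable def kInfusion₁ (A B : Filling) : Option Filling := (switchAll A B).map plainPart

/-! ### The staircase, the superstandard tableau, and the tableau of a word -/

/-- The staircase shape `(n, n-1, …, 2, 1)`. -/
def staircase (n : ℕ) : YoungDiagram where
  cells := (Finset.range n ×ˢ Finset.range n).filter fun c => c.1 + c.2 < n
  isLowerSet := by
    intro a b hab ha
    have h1 := hab.1
    have h2 := hab.2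
    simp only [Finset.coe_filter, Finset.mem_product, Finset.mem_range, Set.mem_ofPred_eq] at ha ⊢
    omega

theorem mem_staircase {n : ℕ} {c : ℕ × ℕ} : c ∈ staircase n ↔ c.1 + c.2 < n := by
  rw [← YoungDiagram.mem_cells]
  simp only [staircase, Finset.mem_filter, Finset.mem_product, Finset.mem_range]
  omega

/-- The superstandard Young tableau of shape `μ`: its first row is `1, 2, …, μ₁`, its
second row is `μ₁ + 1, …, μ₁ + μ₂`, and so on. -/
def superstandard (μ : YoungDiagram) : Filling := fun c =>
  if c ∈ μ then some ((∑ k ∈ Finset.range c.1, μ.rowLen k) + c.2 + 1) else none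

/-- The tableau of skew shape `staircase n / staircase (n-1)` (the `n` boxes of an
antidiagonal) in which `w₁, w₂, …, wₙ` are arranged from southwest to northeast: the only box
in the column with index `k` carries the letter with index `k`. -/
def wordTableau {n : ℕ} (w : Fin n → ℕ) : Filling := fun c =>
  if h : c ∈ staircase n ∧ c ∉ staircase (n - 1) then
    some (w ⟨c.2, by have := mem_staircase.mp h.1; omega⟩)
  else none

end KTab

namespace KTab

/-! ### Labelings and slides -/

/-! The underlined rows of `S` are emptied from the bottom up, and emptying one row performs one
Hecke insertion. Count rows and columns from 0. When the underlined labels below row `d` have been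
processed, the rows below `d` carry the insertion tableau `T` of the first `m = n - 1 - d` letters,
and row `d` consists of `m` underlined labels followed by the next letter. These labels slide out
from right to left, leaving the next insertion tableau `T'` with its top row in row `d`.

One slide is the run of switches `(i, 1), …, (i, q)`. Encode a still underlined box by 0, and a box
outside the shape or taken by an underlined label that has finished sliding by `q + 1`. Let `O` and
`N` be the labels of a box before and after the slide. After the switch `(i, v)` the box holds `i`
if `O ≤ v < N`, and otherwise `N` if `N ≤ v` and `O` if `v < O`. The local rules `IsSlide` on `O`
and `N` suffice for every switch to act in this way and never to give the null tableau
(`SlideState.interchange`).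

For the insertion, let `ξ r` be the number inserted into row `r` of `T`, with `q + 1` after the end.
A row is thought of as continued by labels `q + 1`, so that adjoining is a replacement too
(`IsInsertion`, `heckeInsertRow_spec`). When the slides have reached column `k`, the columns to the
right already agree with `T'` and those to the left are still `T`, one row too low. Column `k` is
that of `T` with `ξ r` squeezed in at the first row with `ξ r < T r k`, the labels above having
moved up. The core is `IsInsertion.isSlide_slideBoard`: consecutive boards of this kind differ by a
slide. -/

/-- The order relation between the labels of neighbouring boxes, where the label `0` stands for a
box that is still underlined and the label `q + 1` for a box outside of the shape. -/
def CellLT (q a b : ℕ) : Prop := a < b ∨ a = b ∧ (a = 0 ∨ a = q + 1)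

/-- An increasing filling of the quarter plane with labels from `0` to `q + 1`, the labels `0`
and `q + 1` being allowed to repeat. -/
structure IsLabeling (q : ℕ) (L : ℕ → ℕ → ℕ) : Prop where
  le : ∀ r c, L r c ≤ q + 1
  right : ∀ r c, CellLT q (L r c) (L r (c + 1))
  down : ∀ r c, CellLT q (L r c) (L (r + 1) c)

theorem CellLT.trans {q a b c : ℕ} (h : CellLT q a b) (h' : CellLT q b c) : CellLT q a c := by
  unfold CellLT at *; omega

theorem CellLT.le {q a b : ℕ} (h : CellLT q a b) : a ≤ b := by
  unfold CellLT at *; omega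

theorem IsLabeling.cellLT_of_lt_right {q : ℕ} {L : ℕ → ℕ → ℕ} (hL : IsLabeling q L) (r : ℕ)
    {c d : ℕ} (h : c < d) : CellLT q (L r c) (L r d) := by
  induction d, h using Nat.le_induction with
  | base => exact hL.right r c
  | succ d _ ih => exact ih.trans (hL.right r d)

theorem IsLabeling.cellLT_of_lt_down {q : ℕ} {L : ℕ → ℕ → ℕ} (hL : IsLabeling q L) (c : ℕ)
    {r s : ℕ} (h : r < s) : CellLT q (L r c) (L s c) := by
  induction s, h using Nat.le_induction with
  | base => exact hL.down r c
  | succ s _ ih => exact ih.trans (hL.down s c)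

/-- The local rules that relate the labels `O` before and the labels `N` after a slide.  The boxes
with `O r c < N r c` are those that the sliding underlined label visits. -/
structure IsSlide (q : ℕ) (O N : ℕ → ℕ → ℕ) : Prop where
  le : ∀ r c, O r c ≤ N r c
  le_right : ∀ r c, O r c < N r c → N r c ≤ O r (c + 1)
  le_down : ∀ r c, O r c < N r c → N r c ≤ O (r + 1) c
  eq : ∀ r c, O r c < N r c → N r c = O r (c + 1) ∨ N r c = O (r + 1) c
  source : ∀ r c, 0 < O r c → O r c ≤ q → O r c < N r c →
    (∃ c', c = c' + 1 ∧ O r c' < O r c ∧ N r c' = O r c) ∨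
      ∃ r', r = r' + 1 ∧ O r' c < O r c ∧ N r' c = O r c
  push_right : ∀ r c, O r c < N r c → N r c = O r (c + 1) → N r c ≤ q → O r (c + 1) < N r (c + 1)
  push_down : ∀ r c, O r c < N r c → N r c = O (r + 1) c → N r c ≤ q → O (r + 1) c < N (r + 1) c

/-- The only danger is a box that takes the label of its right or lower neighbour; `push_right` and
`push_down` make that neighbour pass to a larger label in the same slide. -/
theorem IsSlide.isLabeling {q : ℕ} {O N : ℕ → ℕ → ℕ} (h : IsSlide q O N) (hO : IsLabeling q O) :
    IsLabeling q N where
  le r c := by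
    have h1 := hO.le r c
    have h2 := hO.le r (c + 1)
    have h3 := hO.le (r + 1) c
    have h4 := h.eq r c
    have h5 := h.le r c
    omega
  right r c := by
    have h1 := hO.right r c
    have h2 := h.le r c
    have h3 := h.le r (c + 1)
    have h4 := h.le_right r c
    have h5 := h.push_right r c
    have h6 := hO.le r (c + 1)
    have h7 := h.eq r (c + 1)
    have h8 := hO.le r (c + 1 + 1)
    have h9 := hO.le (r + 1) (c + 1)
    unfold CellLT at *
    omega
  down r c := by
    have h1 := hO.down r c
    have h2 := h.le r c
    have h3 := h.le (r + 1) c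
    have h4 := h.le_down r c
    have h5 := h.push_down r c
    have h6 := hO.le (r + 1) c
    have h7 := h.eq (r + 1) c
    have h8 := hO.le (r + 1) (c + 1)
    have h9 := hO.le (r + 1 + 1) c
    unfold CellLT at *
    omega

/-- While a box holds the sliding label, all boxes further right still have their old labels, larger
than `v`. Hence the sliding label never occurs twice in a row. -/
theorem IsSlide.lt_of_lt_right {q : ℕ} {O N : ℕ → ℕ → ℕ} (h : IsSlide q O N)
    (hO : IsLabeling q O) {r c d v : ℕ} (h1 : O r c ≤ v) (h2 : v < N r c) (hd : c < d) :
    v < O r d := by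
  have h3 := h.le_right r c (by omega)
  rcases eq_or_lt_of_le (Nat.succ_le_of_lt hd) with e | e
  · subst e
    exact h2.trans_le h3
  · exact h2.trans_le (h3.trans (hO.cellLT_of_lt_right r e).le)

theorem IsSlide.lt_of_lt_down {q : ℕ} {O N : ℕ → ℕ → ℕ} (h : IsSlide q O N)
    (hO : IsLabeling q O) {r s c v : ℕ} (h1 : O r c ≤ v) (h2 : v < N r c) (hs : r < s) :
    v < O s c := by
  have h3 := h.le_down r c (by omega)
  rcases eq_or_lt_of_le (Nat.succ_le_of_lt hs) with e | e
  · subst e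
    exact h2.trans_le h3
  · exact h2.trans_le (h3.trans (hO.cellLT_of_lt_down c e).le)

/-! ### Switches -/

theorem boxGraph_adj {c d : ℕ × ℕ} : boxGraph.Adj c d ↔
    (d.1 = c.1 ∧ d.2 = c.2 + 1) ∨ (d.1 = c.1 + 1 ∧ d.2 = c.2) ∨
      (c.1 = d.1 ∧ c.2 = d.2 + 1) ∨ (c.1 = d.1 + 1 ∧ c.2 = d.2) := by
  rcases c with ⟨a, b⟩
  rcases d with ⟨a', b'⟩
  simp only [boxGraph, SimpleGraph.fromRel_adj, ne_eq, Prod.mk.injEq]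
  omega

theorem inNonsingletonComponent_iff {B : Set (ℕ × ℕ)} {c : ℕ × ℕ} :
    InNonsingletonComponent B c ↔ c ∈ B ∧ ∃ d ∈ B, boxGraph.Adj c d := by
  constructor
  · rintro ⟨h, hn⟩
    refine ⟨h, ?_⟩
    obtain ⟨x, hx, hne⟩ := hn.exists_ne ⟨c, h⟩
    rw [SimpleGraph.ConnectedComponent.mem_supp_iff, SimpleGraph.ConnectedComponent.eq] at hx
    obtain ⟨p⟩ := hx.symm
    cases p with
    | nil => exact absurd rfl hne
    | cons hadj _ => exact ⟨_, Subtype.coe_prop _, SimpleGraph.comap_adj.mp hadj⟩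
  · rintro ⟨h, d, hd, hadj⟩
    refine ⟨h, ⟨c, h⟩, rfl, ⟨d, hd⟩, ?_, fun e => hadj.ne (congrArg Subtype.val e)⟩
    rw [SimpleGraph.ConnectedComponent.mem_supp_iff, SimpleGraph.ConnectedComponent.eq]
    exact (SimpleGraph.Adj.reachable (SimpleGraph.comap_adj.mpr hadj)).symm

/-- The state of a slide of the underlined label `i` from `O` to `N` after the
switches `(i, 1), …, (i, v)`. -/
structure SlideState (q : ℕ) (O N : ℕ → ℕ → ℕ) (i v : ℕ) (M : MixedFilling) : Prop where
  mixed : IsMixed M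
  plain : ∀ r c u, M (r, c) = some (.inr u) ↔
    1 ≤ u ∧ u ≤ q ∧ (N r c = u ∧ u ≤ v ∨ O r c = u ∧ v < u)
  dot : ∀ r c, M (r, c) = some (.inl i) ↔ O r c ≤ v ∧ v < N r c

theorem SlideState.mem_switchBoxes {q i v : ℕ} {O N : ℕ → ℕ → ℕ} {M : MixedFilling}
    (h : SlideState q O N i v M) (hv : v + 1 ≤ q) (r c : ℕ) :
    (r, c) ∈ switchBoxes i (v + 1) M ↔ (O r c ≤ v ∧ v < N r c) ∨ O r c = v + 1 := by
  simp only [switchBoxes, Set.mem_ofPred_eq, h.dot, h.plain]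
  omega

/-- A box about to receive `v + 1` finds it to the right or below by `eq`; a box about to lose `v +
1` finds the sliding label to the left or above by `source`. All other boxes concerned are isolated,
by `le_right`, `le_down` and the two push rules. -/
theorem SlideState.inNonsingletonComponent_iff {q i v : ℕ} {O N : ℕ → ℕ → ℕ} {M : MixedFilling}
    (h : SlideState q O N i v M) (hO : IsLabeling q O) (hs : IsSlide q O N) (hv : v + 1 ≤ q)
    (r c : ℕ) : InNonsingletonComponent (switchBoxes i (v + 1) M) (r, c) ↔
      (O r c ≤ v ∧ N r c = v + 1) ∨ (O r c = v + 1 ∧ v + 1 < N r c) := by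
  rw [KTab.inNonsingletonComponent_iff]
  simp only [Prod.exists, h.mem_switchBoxes hv, boxGraph_adj]
  constructor
  · rintro ⟨hc, r', c', hd, hadj⟩
    rcases hadj with ⟨rfl, rfl⟩ | ⟨rfl, rfl⟩ | ⟨rfl, rfl⟩ | ⟨rfl, rfl⟩
    · have h1 := hO.right r' c
      have h2 := hs.le_right r' c
      unfold CellLT at h1
      omega
    · have h1 := hO.down r c'
      have h2 := hs.le_down r c'
      unfold CellLT at h1
      omega
    · have h1 := hO.right r c'
      have h2 := hs.le_right r c'
      have h3 := hs.push_right r c'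
      unfold CellLT at h1
      omega
    · have h1 := hO.down r' c
      have h2 := hs.le_down r' c
      have h3 := hs.push_down r' c
      unfold CellLT at h1
      omega
  · rintro (⟨h1, h2⟩ | ⟨h1, h2⟩)
    · refine ⟨by omega, ?_⟩
      rcases hs.eq r c (by omega) with e | e
      · exact ⟨r, c + 1, by omega, by omega⟩
      · exact ⟨r + 1, c, by omega, by omega⟩
    · refine ⟨by omega, ?_⟩
      rcases hs.source r c (by omega) (by omega) (by omega) with ⟨c', rfl, h3, h4⟩ | ⟨r', rfl, h3, h4⟩
      · exact ⟨r, c', by omega, by omega⟩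
      · exact ⟨r', c, by omega, by omega⟩

theorem interchange_apply_of_ne {i j : ℕ} {M : MixedFilling} {a : ℕ ⊕ ℕ} (hi : a ≠ .inl i)
    (hj : a ≠ .inr j) (c : ℕ × ℕ) : interchange i j M c = some a ↔ M c = some a := by
  unfold interchange
  split_ifs with h1 h2
  · simp [h2, hi.symm, hj.symm]
  · obtain ⟨h, -⟩ := h1
    rcases h with h | h
    · exact absurd h h2
    · simp [h, hi.symm, hj.symm]
  · rfl

theorem SlideState.interchange {q i v : ℕ} {O N : ℕ → ℕ → ℕ} {M : MixedFilling}
    (h : SlideState q O N i v M) (hO : IsLabeling q O) (hs : IsSlide q O N) (hv : v + 1 ≤ q) :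
    SlideState q O N i (v + 1) (interchange i (v + 1) M) := by
  have hns := h.inNonsingletonComponent_iff hO hs hv
  -- After the switch, `v + 1` sits exactly where `N` equals `v + 1`; it does not repeat in a row or
  -- column because `N` is a labeling.
  have hN := hs.isLabeling hO
  have hplain : ∀ r c, KTab.interchange i (v + 1) M (r, c) = some (.inr (v + 1)) ↔
      N r c = v + 1 := by
    intro r c
    have h0 := hs.le r c
    unfold KTab.interchange
    rw [hns r c]
    split_ifs with h1 h2
    · rw [h.dot] at h2
      simp only [true_iff]
      omega
    · rw [h.dot] at h2
      simp only [Option.some.injEq, reduceCtorEq, false_iff]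
      omega
    · rw [h.plain]
      omega
  have hdot : ∀ r c, KTab.interchange i (v + 1) M (r, c) = some (.inl i) ↔
      O r c ≤ v + 1 ∧ v + 1 < N r c := by
    intro r c
    have h0 := hs.le r c
    unfold KTab.interchange
    rw [hns r c]
    split_ifs with h1 h2
    · rw [h.dot] at h2
      simp only [Option.some.injEq, reduceCtorEq, false_iff]
      omega
    · rw [h.dot] at h2
      simp only [true_iff]
      omega
    · rw [h.dot]
      omega
  refine ⟨?_, ?_, hdot⟩
  · rintro ⟨r, c⟩ ⟨r', c'⟩ hne hrc a h1 h2
    simp only [ne_eq, Prod.mk.injEq] at hne hrc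
    by_cases hi : a = .inl i
    · subst hi
      rw [hdot] at h1 h2
      rcases hrc with rfl | rfl
      · rcases lt_or_gt_of_ne (show c ≠ c' by omega) with e | e
        · have := hs.lt_of_lt_right hO h1.1 h1.2 e
          omega
        · have := hs.lt_of_lt_right hO h2.1 h2.2 e
          omega
      · rcases lt_or_gt_of_ne (show r ≠ r' by omega) with e | e
        · have := hs.lt_of_lt_down hO h1.1 h1.2 e
          omega
        · have := hs.lt_of_lt_down hO h2.1 h2.2 e
          omega
    · by_cases hj : a = .inr (v + 1)
      · subst hj
        rw [hplain] at h1 h2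
        rcases hrc with rfl | rfl
        · rcases lt_or_gt_of_ne (show c ≠ c' by omega) with e | e <;>
          · have := hN.cellLT_of_lt_right r e
            unfold CellLT at this; omega
        · rcases lt_or_gt_of_ne (show r ≠ r' by omega) with e | e <;>
          · have := hN.cellLT_of_lt_down c e
            unfold CellLT at this; omega
      · rw [interchange_apply_of_ne hi hj] at h1 h2
        exact h.mixed (r, c) (r', c') (by simpa using hne) hrc a h1 h2
  · intro r c u
    by_cases hu : u = v + 1
    · subst hu
      rw [hplain]
      omega
    · rw [interchange_apply_of_ne (by simp) (by simpa using hu), h.plain]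
      omega

/-- The switches `(i, 1), …, (i, q)`. -/
noncomputable def slide (q i : ℕ) (M : Option MixedFilling) : Option MixedFilling :=
  (List.range' 1 q).foldl (fun M j => switch i j M) M

theorem SlideState.exists_foldl {q i : ℕ} {O N : ℕ → ℕ → ℕ} {M : MixedFilling}
    (h : SlideState q O N i 0 M) (hO : IsLabeling q O) (hs : IsSlide q O N) {v : ℕ} (hv : v ≤ q) :
    ∃ M', (List.range' 1 v).foldl (fun M j => switch i j M) (some M) = some M' ∧
      SlideState q O N i v M' ∧
      ∀ i' ≠ i, ∀ c, M' c = some (.inl i') ↔ M c = some (.inl i') := by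
  induction v with
  | zero => exact ⟨M, rfl, h, fun _ _ _ => Iff.rfl⟩
  | succ v ih =>
    obtain ⟨M', h1, h2, h3⟩ := ih (by omega)
    have h4 := h2.interchange hO hs hv
    refine ⟨_, ?_, h4, fun i' hi' c => ?_⟩
    · rw [List.range'_1_concat, List.foldl_append, h1, add_comm 1 v]
      simp only [List.foldl_cons, List.foldl_nil, switch, if_pos h4.mixed]
    · rw [interchange_apply_of_ne (by simpa using hi') (by simp), h3 i' hi']

/-- The plain part of the mixed tableau `M` is given by the labeling `L`, and its underlined labels
up to `p` are those of `S`. -/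
structure Represents (q : ℕ) (S : Filling) (p : ℕ) (L : ℕ → ℕ → ℕ) (M : MixedFilling) : Prop where
  labeling : IsLabeling q L
  mixed : IsMixed M
  plain : ∀ r c u, M (r, c) = some (.inr u) ↔ 1 ≤ u ∧ u ≤ q ∧ L r c = u
  underlined : ∀ i, i ≤ p → ∀ r c, M (r, c) = some (.inl i) ↔ S (r, c) = some i

/-- The hypothesis `hstart` is the description of the sliding label at `v = 0`: it sits where `O ≤ 0
< N`. -/
theorem Represents.exists_slide {q p : ℕ} {S : Filling} {O N : ℕ → ℕ → ℕ} {M : MixedFilling}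
    (h : Represents q S (p + 1) O M) (hs : IsSlide q O N)
    (hstart : ∀ r c, S (r, c) = some (p + 1) ↔ O r c = 0 ∧ 0 < N r c) :
    ∃ M', slide q (p + 1) (some M) = some M' ∧ Represents q S p N M' := by
  have h0 : SlideState q O N (p + 1) 0 M := by
    refine ⟨h.mixed, fun r c u => ?_, fun r c => ?_⟩
    · rw [h.plain]
      omega
    · rw [h.underlined _ le_rfl, hstart]
      omega
  obtain ⟨M', h1, h2, h3⟩ := h0.exists_foldl h.labeling hs le_rfl
  refine ⟨M', h1, hs.isLabeling h.labeling, h2.mixed, fun r c u => ?_, fun i hi r c => ?_⟩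
  · rw [h2.plain]
    omega
  · rw [h3 i (by omega), h.underlined i (by omega)]

/-! ### The slides that perform a Hecke insertion -/

/-- Shift the rows down by one, with zeros in the new first row. -/
def padTop (T : ℕ → ℕ → ℕ) : ℕ → ℕ → ℕ
  | 0, _ => 0
  | r + 1, c => T r c

/-- Shift the columns to the right by one, with zeros in the new first column. -/
def padLeft (T : ℕ → ℕ → ℕ) : ℕ → ℕ → ℕ
  | _, 0 => 0
  | r, c + 1 => T r c

/-- `T'` is the result of a Hecke insertion into `T` in which `ξ r` is inserted into the row with
index `r`, the label `q + 1` meaning that the insertion has stopped. -/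
structure IsInsertion (q : ℕ) (T T' : ℕ → ℕ → ℕ) (ξ : ℕ → ℕ) : Prop where
  pos : ∀ r, 0 < ξ r
  le : ∀ r, ξ r ≤ q + 1
  lt : ∀ r, ξ r < ξ (r + 1) ∨ ξ (r + 1) = q + 1
  next : ∀ r c, padLeft T r c ≤ ξ r → ξ r < T r c → ξ (r + 1) = T r c
  same_of_le : ∀ r c, T r c ≤ ξ r → T' r c = T r c
  same_of_lt : ∀ r c, ξ r < padLeft T r c → T' r c = T r c
  replace : ∀ r c, padLeft T r c < ξ r → ξ r < T r c → padTop T' r c < ξ r → T' r c = ξ r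
  fail_left : ∀ r c, padLeft T r c = ξ r → T' r c = T r c
  fail_top : ∀ r c, ξ r ≤ padTop T' r c → T' r c = T r c

/-- At the first label larger than `ξ r` this is `next`, and further right the labels only grow. In
effect, the insertion path moves weakly to the left. -/
theorem IsInsertion.next_le {q : ℕ} {T T' : ℕ → ℕ → ℕ} {ξ : ℕ → ℕ} (h : IsInsertion q T T' ξ)
    (hT : IsLabeling q T) (r c : ℕ) (hc : ξ r < T r c) : ξ (r + 1) ≤ T r c := by
  induction c with
  | zero => exact (h.next r 0 (Nat.zero_le _) hc).le
  | succ c ih =>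
    by_cases hle : T r c ≤ ξ r
    · exact (h.next r (c + 1) hle hc).le
    · exact (ih (by omega)).trans (hT.right r c).le

/-- The column with index `c` when the slides have reached it. -/
def slideColumn (T : ℕ → ℕ → ℕ) (ξ : ℕ → ℕ) (r c : ℕ) : ℕ :=
  max (padTop T r c) (min (T r c) (ξ r))

/-- The labeling when the slides have reached the column with index `k`. -/
def slideBoard (T T' : ℕ → ℕ → ℕ) (ξ : ℕ → ℕ) (k r c : ℕ) : ℕ :=
  if c < k then padTop T r c else if c = k then slideColumn T ξ r c else T' r c

section
variable {q : ℕ} {T T' : ℕ → ℕ → ℕ} {ξ : ℕ → ℕ}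

theorem slideBoard_of_lt {k c : ℕ} (h : c < k) (r : ℕ) :
    slideBoard T T' ξ k r c = padTop T r c := by simp [slideBoard, h]

theorem slideBoard_self (k r : ℕ) :
    slideBoard T T' ξ k r k = slideColumn T ξ r k := by simp [slideBoard]

theorem slideBoard_of_gt {k c : ℕ} (h : k < c) (r : ℕ) :
    slideBoard T T' ξ k r c = T' r c := by
  simp [slideBoard, h.ne', not_lt.mpr h.le]

theorem slideBoard_succ_of_ne {k c : ℕ} (h : c ≠ k) (h' : c ≠ k + 1) (r : ℕ) :
    slideBoard T T' ξ (k + 1) r c = slideBoard T T' ξ k r c := by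
  rcases lt_or_gt_of_ne h with h | h
  · rw [slideBoard_of_lt h, slideBoard_of_lt (by omega)]
  · rw [slideBoard_of_gt h, slideBoard_of_gt (by omega)]

theorem slideBoard_lt_imp {k r c : ℕ}
    (h : slideBoard T T' ξ (k + 1) r c < slideBoard T T' ξ k r c) : c = k ∨ c = k + 1 := by
  by_contra hc
  rw [slideBoard_succ_of_ne (by omega) (by omega)] at h
  omega

theorem IsInsertion.row_facts (h : IsInsertion q T T' ξ) (hT : IsLabeling q T) (r k : ℕ) :
    (ξ r ≤ q + 1 ∧ T r k ≤ q + 1 ∧ T r (k + 1) ≤ q + 1) ∧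
    (ξ r < ξ (r + 1) ∨ ξ (r + 1) = q + 1) ∧
    (T r k ≤ ξ r → ξ r < T r (k + 1) → ξ (r + 1) = T r (k + 1)) ∧
    (ξ r < T r k → ξ (r + 1) ≤ T r k) ∧
    (T r k < T r (k + 1) ∨ T r k = T r (k + 1) ∧ (T r k = 0 ∨ T r k = q + 1)) ∧
    (T r k < T (r + 1) k ∨ T r k = T (r + 1) k ∧ (T r k = 0 ∨ T r k = q + 1)) ∧
    (T r (k + 1) < T (r + 1) (k + 1) ∨
      T r (k + 1) = T (r + 1) (k + 1) ∧ (T r (k + 1) = 0 ∨ T r (k + 1) = q + 1)) :=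
  ⟨⟨h.le r, hT.le _ _, hT.le _ _⟩, h.lt r, h.next r (k + 1), h.next_le hT r k, hT.right r k,
    hT.down r k, hT.down r (k + 1)⟩

theorem IsInsertion.row_facts' (h : IsInsertion q T T' ξ) (r k : ℕ) :
    (T r (k + 1) ≤ ξ r → T' r (k + 1) = T r (k + 1)) ∧
    (ξ r < T r k → T' r (k + 1) = T r (k + 1)) ∧
    (T r k < ξ r → ξ r < T r (k + 1) → padTop T' r (k + 1) < ξ r → T' r (k + 1) = ξ r) ∧
    (T r k = ξ r → T' r (k + 1) = T r (k + 1)) ∧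
    (ξ r ≤ padTop T' r (k + 1) → T' r (k + 1) = T r (k + 1)) :=
  ⟨h.same_of_le r (k + 1), h.same_of_lt r (k + 1), h.replace r (k + 1), h.fail_left r (k + 1),
    h.fail_top r (k + 1)⟩

theorem IsInsertion.slideColumn_le (h : IsInsertion q T T' ξ) (hT : IsLabeling q T) (r k : ℕ) :
    slideColumn T ξ r (k + 1) ≤ T' r (k + 1) := by
  have f := h.row_facts hT r k
  have f' := h.row_facts' r k
  rcases r with _ | r
  · simp only [slideColumn, padTop] at *
    omega
  · have g := h.row_facts hT r k
    have g' := h.row_facts' r k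
    simp only [slideColumn, padTop] at *
    omega

/-- By `next_le`, the labels at and below the insertion path wait for the next slide, still one row
too low. -/
theorem IsInsertion.slideColumn_succ_of_lt (h : IsInsertion q T T' ξ) (hT : IsLabeling q T)
    {r c : ℕ} (hr : ξ r < T r c) : slideColumn T ξ (r + 1) c = T r c := by
  have h1 := h.next_le hT r c hr
  simp only [slideColumn, padTop]
  omega

/-- Above the insertion path the labels have already moved up: the label of `T` in the row above is
no larger than `T r c`. -/
theorem slideColumn_of_le (hT : IsLabeling q T) {r c : ℕ} (hr : T r c ≤ ξ r) :
    slideColumn T ξ r c = T r c := by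
  rcases r with _ | r
  · simp only [slideColumn, padTop]
    omega
  · have := (hT.down r c).le
    simp only [slideColumn, padTop]
    omega

theorem IsInsertion.le_of_lt_slideColumn (h : IsInsertion q T T' ξ) (hT : IsLabeling q T)
    {r c : ℕ} (hc : T r c < slideColumn T ξ (r + 1) c) : T r c ≤ ξ r := by
  by_contra hr
  rw [h.slideColumn_succ_of_lt hT (not_le.mp hr)] at hc
  exact lt_irrefl _ hc

/-- A successful replacement puts `ξ r` where the board already has it. So the slide changes this
column only where `T r (c + 1)` exceeds `ξ r` but was not replaced. -/
theorem IsInsertion.eq_of_slideColumn_lt (h : IsInsertion q T T' ξ) {r c : ℕ}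
    (hc : slideColumn T ξ r (c + 1) < T' r (c + 1)) :
    T' r (c + 1) = T r (c + 1) ∧ ξ r < T r (c + 1) := by
  have f := h.row_facts' r c
  simp only [slideColumn] at hc
  omega

/-- The sliding label descends column `k`, pulling labels up, until it reaches a row with `ξ r < T r
k`; there it draws `ξ r` from the right and goes on down column `k + 1`. If `T r k = ξ r`, this
label is drawn from below and from the right at once, and the path forks: `T r (k + 1)` is then
pulled up and survives in row `r`, which is the failure of a replacement because of the left
neighbour. If `ξ r` is pulled up inside column `k + 1`, the same happens one row further down: the
failure because of the upper neighbour. Otherwise `ξ r` stays in column `k + 1`, and the replacement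
succeeds. -/
theorem IsInsertion.isSlide_slideBoard (h : IsInsertion q T T' ξ) (hT : IsLabeling q T)
    (hT' : IsLabeling q T') (k : ℕ) :
    IsSlide q (slideBoard T T' ξ (k + 1)) (slideBoard T T' ξ k) := by
  have hlt : k < k + 1 := by omega
  have hlt' : k + 1 < k + 1 + 1 := by omega
  refine ⟨?_, ?_, ?_, ?_, ?_, ?_, ?_⟩
  · intro r c
    by_cases hc : c = k
    · subst hc
      rw [slideBoard_of_lt hlt, slideBoard_self]
      exact le_max_left _ _
    by_cases hc' : c = k + 1
    · subst hc'
      rw [slideBoard_of_gt hlt, slideBoard_self]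
      exact h.slideColumn_le hT r k
    · exact (slideBoard_succ_of_ne hc hc' r).le
  · intro r c hc
    rcases slideBoard_lt_imp hc with rfl | rfl
    · rw [slideBoard_of_lt hlt, slideBoard_self] at hc
      rw [slideBoard_self, slideBoard_self]
      have f := (hT.right r c).le
      rcases r with _ | r
      · simp only [slideColumn, padTop] at *
        omega
      · have g := (hT.right r c).le
        simp only [slideColumn, padTop] at *
        omega
    · rw [slideBoard_of_gt hlt', slideBoard_of_gt hlt]
      exact (hT'.right r (k + 1)).le
  · intro r c hc
    rcases slideBoard_lt_imp hc with rfl | rfl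
    · rw [slideBoard_of_lt hlt, slideBoard_self] at hc
      rw [slideBoard_of_lt hlt, slideBoard_self]
      simp only [slideColumn, padTop] at *
      omega
    · rw [slideBoard_of_gt hlt, slideBoard_self] at hc
      rw [slideBoard_self, slideBoard_of_gt hlt]
      obtain ⟨h1, h2⟩ := h.eq_of_slideColumn_lt hc
      rw [h.slideColumn_succ_of_lt hT h2, h1]
  · intro r c hc
    rcases slideBoard_lt_imp hc with rfl | rfl
    · rw [slideBoard_of_lt hlt, slideBoard_self] at hc
      rw [slideBoard_of_lt hlt, slideBoard_self, slideBoard_self]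
      have f := (hT.right r c).le
      rcases r with _ | r
      · simp only [slideColumn, padTop] at *
        omega
      · have f1 := h.le_of_lt_slideColumn hT hc
        -- If `T r (c + 1)` has not moved up, it equals `ξ (r + 1)`; so the box on the right offers
        -- `ξ (r + 1)` in either case.
        have f2 := h.next r (c + 1) f1
        have f3 := h.lt r
        have f4 := hT.le r (c + 1)
        have f5 := (hT.down r (c + 1)).le
        have f6 := (hT.down r c).le
        simp only [slideColumn, padTop] at *
        omega
    · rw [slideBoard_of_gt hlt, slideBoard_self] at hc
      rw [slideBoard_self, slideBoard_of_gt hlt]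
      obtain ⟨h1, h2⟩ := h.eq_of_slideColumn_lt hc
      rw [h.slideColumn_succ_of_lt hT h2, h1]
      exact .inr rfl
  · intro r c h0 hq hc
    rcases slideBoard_lt_imp hc with rfl | rfl
    · rw [slideBoard_of_lt hlt] at h0 hq
      rcases r with _ | r
      · simp [padTop] at h0
      right
      refine ⟨r, rfl, ?_⟩
      rw [slideBoard_of_lt hlt, slideBoard_self] at hc
      rw [slideBoard_of_lt hlt, slideBoard_of_lt hlt, slideBoard_self]
      simp only [padTop] at hc h0 hq
      rw [slideColumn_of_le hT (h.le_of_lt_slideColumn hT hc)]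
      refine ⟨?_, rfl⟩
      rcases r with _ | r
      · exact h0
      · have := hT.down r c
        simp only [CellLT, padTop] at *
        omega
    · rw [slideBoard_self] at h0 hq
      rw [slideBoard_of_gt hlt, slideBoard_self] at hc
      obtain ⟨h1, h2⟩ := h.eq_of_slideColumn_lt hc
      rw [slideBoard_self]
      have f := h.row_facts' r k
      have f2 := hT.le r (k + 1)
      rcases r with _ | r
      · refine .inl ⟨k, rfl, ?_⟩
        rw [slideBoard_of_lt hlt, slideBoard_self]
        have := h.pos 0
        simp only [slideColumn, padTop] at *
        omega
      have f3 := (hT.right r k).le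
      by_cases hr : ξ r < T r (k + 1)
      · rw [h.slideColumn_succ_of_lt hT hr] at *
        -- If row `r` keeps its label, that label was pulled up and the sliding label arrives from
        -- above. If it was replaced, then `T r (k + 1) = ξ (r + 1)` is drawn to the left, and the
        -- sliding label arrives from column `k`.
        by_cases hn : T' r (k + 1) = T r (k + 1)
        · refine .inr ⟨r, rfl, ?_⟩
          rw [slideBoard_self, slideBoard_of_gt hlt]
          refine ⟨?_, hn⟩
          rcases r with _ | r
          · simp only [slideColumn, padTop] at *
            omega
          · have := hT.down r (k + 1)
            simp only [slideColumn, padTop, CellLT] at *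
            omega
        · refine .inl ⟨k, rfl, ?_⟩
          rw [slideBoard_of_lt hlt, slideBoard_self]
          have g := h.row_facts' r k
          have e := h.next r (k + 1)
          have e' := hT.right r k
          simp only [slideColumn, padTop, padLeft, CellLT] at *
          omega
      · refine .inl ⟨k, rfl, ?_⟩
        rw [slideBoard_of_lt hlt, slideBoard_self]
        have g := h.same_of_le r (k + 1) (not_lt.mp hr)
        have e := h.lt r
        simp only [slideColumn, padTop] at *
        omega
  · intro r c hc he hq
    rcases slideBoard_lt_imp hc with rfl | rfl
    · rw [slideBoard_of_lt hlt, slideBoard_self] at hc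
      rw [slideBoard_self] at he hq
      rw [slideBoard_self] at he
      rw [slideBoard_self, slideBoard_of_gt hlt]
      have f := h.row_facts' r c
      have g := hT.right r c
      simp only [slideColumn, CellLT] at *
      omega
    -- Out of column `k + 1` there is no step to the right: it would need two equal plain labels
    -- side by side in `T'`.
    · exfalso
      rw [slideBoard_of_gt hlt] at hc he hq
      rw [slideBoard_self] at hc
      rw [slideBoard_of_gt hlt'] at he
      have := hT'.right r (k + 1)
      unfold CellLT at this
      omega
  · intro r c hc he hq
    rcases slideBoard_lt_imp hc with rfl | rfl
    · rw [slideBoard_of_lt hlt, slideBoard_self] at hc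
      rw [slideBoard_self] at he hq
      rw [slideBoard_of_lt hlt] at he
      rw [slideBoard_of_lt hlt, slideBoard_self]
      have f := hT.down r c
      have g := h.lt r
      simp only [slideColumn, padTop, CellLT] at *
      omega
    · rw [slideBoard_of_gt hlt, slideBoard_self] at hc
      rw [slideBoard_of_gt hlt] at he hq
      rw [slideBoard_self, slideBoard_of_gt hlt]
      obtain ⟨h1, h2⟩ := h.eq_of_slideColumn_lt hc
      rw [h.slideColumn_succ_of_lt hT h2]
      have g' := h.row_facts' (r + 1) k
      have := hT'.down r (k + 1)
      simp only [CellLT] at *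
      omega

/-- No replacement fails in column 0. There is no left neighbour, and the label above is smaller:
either it is at most the number inserted in that row, or it was itself bumped and replaced by a
smaller one. -/
theorem IsInsertion.slideBoard_zero (h : IsInsertion q T T' ξ) (hT : IsLabeling q T) :
    slideBoard T T' ξ 0 = T' := by
  have hξ : ∀ r, ξ r < T r 0 → T' r 0 = ξ r := by
    intro r hr
    have h1 := h.replace r 0 (h.pos r) hr
    induction r with
    | zero => exact h1 (h.pos 0)
    | succ r ih =>
      refine h1 ?_
      have f := h.lt r
      have g := h.same_of_le r 0
      have e := h.replace r 0 (h.pos r)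
      have d := h.next r 0 (Nat.zero_le _)
      have f2 := hT.down r 0
      have f3 := hT.le (r + 1) 0
      simp only [CellLT, padTop] at *
      by_cases hr' : ξ r < T r 0
      · have := ih hr' (e hr')
        omega
      · omega
  funext r c
  rcases Nat.eq_zero_or_pos c with rfl | hc
  · rw [slideBoard_self]
    have f := h.row_facts hT r 0
    have g := hξ r
    have e := h.same_of_le r 0
    rcases r with _ | r
    · simp only [slideColumn, padTop] at *
      omega
    · have f := h.row_facts hT r 0
      have d := h.next r 0 (Nat.zero_le _)
      simp only [slideColumn, padTop] at *
      omega
  · exact slideBoard_of_gt hc r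
end
/-! ### Hecke insertion in terms of labelings -/

/-- The labeling of the quarter plane given by a list of rows, with the label `q + 1` outside of
the shape. -/
def entry (q : ℕ) (T : List (List ℕ)) (r c : ℕ) : ℕ := ((row T r)[c]?).getD (q + 1)

/-- All the labels of `T` lie between `1` and `q`. -/
def LabelsIn (q : ℕ) (T : List (List ℕ)) : Prop := ∀ r, ∀ a ∈ row T r, 1 ≤ a ∧ a ≤ q

theorem row_eq_getElem {T : List (List ℕ)} {r : ℕ} (h : r < T.length) : row T r = T[r] := by
  simp [row, h]

theorem row_of_le {T : List (List ℕ)} {r : ℕ} (h : T.length ≤ r) : row T r = [] := by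
  simp [row, h]

theorem entry_of_lt {q : ℕ} {T : List (List ℕ)} {r c : ℕ} (h : c < (row T r).length) :
    entry q T r c = (row T r)[c] := by
  simp [entry, h]

theorem entry_of_le {q : ℕ} {T : List (List ℕ)} {r c : ℕ} (h : (row T r).length ≤ c) :
    entry q T r c = q + 1 := by
  simp [entry, h]

theorem LabelsIn.entry_mem {q : ℕ} {T : List (List ℕ)} (hT : LabelsIn q T) {r c : ℕ}
    (h : c < (row T r).length) : 1 ≤ entry q T r c ∧ entry q T r c ≤ q := by
  rw [entry_of_lt h]
  exact hT r _ (List.getElem_mem h)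

theorem LabelsIn.entry_le {q : ℕ} {T : List (List ℕ)} (hT : LabelsIn q T) (r c : ℕ) :
    1 ≤ entry q T r c ∧ entry q T r c ≤ q + 1 := by
  rcases lt_or_ge c (row T r).length with h | h
  · have := hT.entry_mem h
    omega
  · rw [entry_of_le h]
    omega

theorem forall_mem_zip_iff {s t : List ℕ} : (∀ e ∈ s.zip t, e.1 < e.2) ↔
    ∀ c (h : c < s.length) (h' : c < t.length), s[c] < t[c] := by
  rw [List.forall_mem_iff_forall_getElem]
  simp only [List.length_zip, List.getElem_zip]
  exact ⟨fun h c h1 h2 => h c (by omega), fun h c h1 => h c (by omega) (by omega)⟩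

/-- The constant `q + 1` also encodes the shape: no label up to `q` may follow it to the right or
below, so row lengths decrease weakly. Nonempty rows are a separate condition because `entry` does
not see empty rows at the end of the list. -/
theorem isIncreasing_iff {q : ℕ} {T : List (List ℕ)} (hT : LabelsIn q T) : IsIncreasing T ↔
    (∀ r, r < T.length → row T r ≠ []) ∧ IsLabeling q (entry q T) := by
  unfold IsIncreasing
  rw [List.forall_mem_iff_forall_getElem, List.isChain_iff_getElem]
  simp only [forall_mem_zip_iff, ← List.isChain_iff_pairwise, List.isChain_iff_getElem]
  constructor
  · rintro ⟨h1, h2⟩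
    refine ⟨fun r hr => by rw [row_eq_getElem hr]; exact (h1 r hr).1,
      fun r c => (hT.entry_le r c).2, fun r c => ?_, fun r c => ?_⟩
    · have := (hT.entry_le r c).2
      rcases lt_or_ge (c + 1) (row T r).length with h | h
      · have hr : r < T.length := by
          by_contra hr
          simp [row_of_le (not_lt.mp hr)] at h
        left
        rw [entry_of_lt h, entry_of_lt (by omega)]
        simp only [row_eq_getElem hr] at h ⊢
        exact (h1 r hr).2 c h
      · rw [entry_of_le h]
        unfold CellLT
        omega
    · have := (hT.entry_le r c).2
      rcases lt_or_ge c (row T (r + 1)).length with h | h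
      · have hr : r + 1 < T.length := by
          by_contra hr
          simp [row_of_le (not_lt.mp hr)] at h
        have hr' : r < T.length := by omega
        have h3 := h2 r hr
        have h4 : c < (row T r).length := by
          rw [row_eq_getElem hr] at h
          rw [row_eq_getElem hr']
          omega
        left
        rw [entry_of_lt h, entry_of_lt h4]
        simp only [row_eq_getElem hr, row_eq_getElem hr'] at h h4 ⊢
        exact h3.2 c h4 h
      · rw [entry_of_le h]
        unfold CellLT
        omega
  · rintro ⟨h1, h2⟩
    refine ⟨fun r hr => ⟨by have := h1 r hr; rwa [row_eq_getElem hr] at this, fun c hc => ?_⟩,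
      fun r hr => ⟨?_, fun c hc hc' => ?_⟩⟩
    · have h3 := h2.right r c
      rw [← row_eq_getElem hr] at hc
      have h4 := hT.entry_mem hc
      rw [entry_of_lt hc, entry_of_lt (by omega)] at h3
      rw [entry_of_lt hc] at h4
      simp only [row_eq_getElem hr, CellLT] at h3 h4
      omega
    · by_contra hlen
      have hr' : r < T.length := by omega
      have h3 := h2.down r (row T r).length
      rw [entry_of_le le_rfl] at h3
      rw [← row_eq_getElem hr, ← row_eq_getElem hr'] at hlen
      have h4 := hT.entry_mem (not_le.mp hlen)
      unfold CellLT at h3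
      omega
    · have hr' : r < T.length := by omega
      have h3 := h2.down r c
      rw [← row_eq_getElem hr] at hc'
      rw [← row_eq_getElem hr'] at hc
      have h4 := hT.entry_mem hc'
      rw [entry_of_lt hc, entry_of_lt hc'] at h3
      rw [entry_of_lt hc'] at h4
      simp only [row_eq_getElem hr, row_eq_getElem hr', CellLT] at h3 h4
      omega

/-- `C` arises from `T` by writing `x` into the box `(i, j)`. -/
structure IsUpdate (q : ℕ) (T C : List (List ℕ)) (i j x : ℕ) : Prop where
  labels : LabelsIn q C
  nonempty : ∀ r, r < C.length → row C r ≠ []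
  row_eq : ∀ r, r ≠ i → row C r = row T r
  le_length : T.length ≤ C.length
  entry_self : entry q C i j = x
  entry_eq : ∀ c, c ≠ j → entry q C i c = entry q T i c

theorem row_set {T : List (List ℕ)} {i : ℕ} (hi : i < T.length) (s : List ℕ) (r : ℕ) :
    row (T.set i s) r = if r = i then s else row T r := by
  unfold row
  simp only [List.getD_eq_getElem?_getD, List.getElem?_set]
  split_ifs <;> first | rfl | omega

theorem IsUpdate.of_rows {q : ℕ} {T C : List (List ℕ)} {i j x : ℕ} (hT : LabelsIn q T)
    (hne : ∀ r, r < T.length → row T r ≠ []) (hx : 1 ≤ x ∧ x ≤ q) (hlen : T.length ≤ C.length)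
    (hlen' : ∀ r < C.length, r ≠ i → r < T.length)
    (hrow : ∀ r, r ≠ i → row C r = row T r) (hi : ∀ a ∈ row C i, a = x ∨ a ∈ row T i)
    (hj : (row C i)[j]? = some x) (hc : ∀ c, c ≠ j → (row C i)[c]? = (row T i)[c]?) :
    IsUpdate q T C i j x where
  labels r a ha := by
    by_cases h : r = i
    · subst h
      rcases hi a ha with rfl | h
      · exact hx
      · exact hT _ a h
    · rw [hrow r h] at ha
      exact hT r a ha
  nonempty r hr := by
    by_cases h : r = i
    · subst h
      intro h0
      simp [h0] at hj
    · rw [hrow r h]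
      exact hne r (hlen' r hr h)
  row_eq := hrow
  le_length := hlen
  entry_self := by simp [entry, hj]
  entry_eq c h := by simp [entry, hc c h]

/-- Lowering the label of one box cannot spoil the inequalities with the right and lower neighbours,
so only the left and upper ones are tested. -/
theorem IsUpdate.isIncreasing_iff {q : ℕ} {T C : List (List ℕ)} {i j x : ℕ}
    (h : IsUpdate q T C i j x) (hT : IsLabeling q (entry q T)) (hx : 1 ≤ x ∧ x ≤ q)
    (hj : x < entry q T i j) : IsIncreasing C ↔
      padLeft (entry q T) i j < x ∧ padTop (entry q T) i j < x := by
  have hrow : ∀ r, r ≠ i → ∀ c, entry q C r c = entry q T r c := by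
    intro r hr c
    simp [entry, h.row_eq r hr]
  rw [KTab.isIncreasing_iff h.labels, and_iff_right h.nonempty]
  constructor
  · intro hC
    constructor
    · rcases j with _ | j
      · exact hx.1
      · have := hC.right i j
        rw [h.entry_self, h.entry_eq j (by omega)] at this
        simp only [CellLT, padLeft] at *
        omega
    · rcases i with _ | i
      · exact hx.1
      · have := hC.down i j
        rw [h.entry_self, hrow i (by omega)] at this
        simp only [CellLT, padTop] at *
        omega
  · rintro ⟨h1, h2⟩
    refine ⟨fun r c => (h.labels.entry_le r c).2, fun r c => ?_, fun r c => ?_⟩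
    · by_cases hr : r = i
      · subst hr
        have h3 := hT.right r c
        by_cases hc : c = j
        · subst hc
          rw [h.entry_self, h.entry_eq (c + 1) (by omega)]
          unfold CellLT at *
          omega
        · rw [h.entry_eq c hc]
          by_cases hc' : c + 1 = j
          · subst hc'
            rw [h.entry_self]
            exact .inl h1
          · rwa [h.entry_eq _ hc']
      · rw [hrow r hr, hrow r hr]
        exact hT.right r c
    · have h3 := hT.down r c
      by_cases hc : c = j
      · subst hc
        by_cases hr : r = i
        · subst hr
          rw [h.entry_self, hrow (r + 1) (by omega)]
          unfold CellLT at *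
          omega
        · rw [hrow r hr]
          by_cases hr' : r + 1 = i
          · subst hr'
            rw [h.entry_self]
            exact .inl h2
          · rwa [hrow _ hr']
      · have h4 : ∀ r, entry q C r c = entry q T r c := fun r => by
          by_cases hr : r = i
          · subst hr
            exact h.entry_eq c hc
          · exact hrow r hr c
        rwa [h4, h4]

theorem isUpdate_set {q : ℕ} {T : List (List ℕ)} {i j x : ℕ} (hT : LabelsIn q T)
    (hne : ∀ r, r < T.length → row T r ≠ []) (hx : 1 ≤ x ∧ x ≤ q) (hj : j < (row T i).length) :
    IsUpdate q T (T.set i ((row T i).set j x)) i j x := by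
  have hi : i < T.length := by
    by_contra hi
    simp [row_of_le (not_lt.mp hi)] at hj
  have hrow := row_set hi ((row T i).set j x)
  refine .of_rows hT hne hx (by simp) (by simp +contextual) (fun r hr => by rw [hrow, if_neg hr]) ?_ ?_ ?_
  · rw [hrow, if_pos rfl]
    intro a ha
    exact (List.mem_or_eq_of_mem_set ha).symm
  · rw [hrow, if_pos rfl]
    simp [hj]
  · rw [hrow, if_pos rfl]
    intro c hc
    rw [List.getElem?_set_ne hc.symm]

theorem row_adjoin {T : List (List ℕ)} {i : ℕ} (hi : i ≤ T.length) (x r : ℕ) :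
    row (adjoin T i x) r = if r = i then row T i ++ [x] else row T r := by
  unfold adjoin
  split_ifs with h1 h2 h2
  · rw [row_set h1, if_pos h2]
  · rw [row_set h1, if_neg h2]
  · obtain rfl : i = T.length := by omega
    subst h2
    simp [row]
  · obtain rfl : i = T.length := by omega
    unfold row
    rw [List.getD_eq_getElem?_getD, List.getD_eq_getElem?_getD, List.getElem?_append]
    split_ifs with h3
    · rfl
    · rw [List.getElem?_eq_none (by simp; omega), List.getElem?_eq_none (by omega)]

theorem isUpdate_adjoin {q : ℕ} {T : List (List ℕ)} {i x : ℕ} (hT : LabelsIn q T)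
    (hne : ∀ r, r < T.length → row T r ≠ []) (hx : 1 ≤ x ∧ x ≤ q) (hi : i ≤ T.length) :
    IsUpdate q T (adjoin T i x) i (row T i).length x := by
  have hrow := row_adjoin hi x
  refine .of_rows hT hne hx ?_ ?_ (fun r hr => by rw [hrow, if_neg hr]) ?_ ?_ ?_
  · unfold adjoin
    split_ifs <;> simp
  · unfold adjoin
    split_ifs
    · simp +contextual
    · simp only [List.length_append, List.length_singleton]
      omega
  · rw [hrow, if_pos rfl]
    intro a ha
    simpa [or_comm] using ha
  · rw [hrow, if_pos rfl]
    simp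
  · rw [hrow, if_pos rfl]
    intro c hc
    rw [List.getElem?_append]
    split_ifs with h
    · rfl
    · rw [List.getElem?_eq_none (by simp; omega), List.getElem?_eq_none (by omega)]

/-- The part of `IsInsertion` that concerns the row with index `r`. -/
structure IsInsertionAt (q : ℕ) (T T' : ℕ → ℕ → ℕ) (r x y : ℕ) : Prop where
  pos : 0 < x
  le : x ≤ q + 1
  lt : x < y ∨ y = q + 1
  next : ∀ c, padLeft T r c ≤ x → x < T r c → y = T r c
  same_of_le : ∀ c, T r c ≤ x → T' r c = T r c
  same_of_lt : ∀ c, x < padLeft T r c → T' r c = T r c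
  replace : ∀ c, padLeft T r c < x → x < T r c → padTop T' r c < x → T' r c = x
  fail_left : ∀ c, padLeft T r c = x → T' r c = T r c
  fail_top : ∀ c, x ≤ padTop T' r c → T' r c = T r c

/-- The rules for row `r` involve only that row before and after, and the row above it after the
insertion. This lets them pass between the successive tableaux of the recursion. -/
theorem IsInsertionAt.congr {q r x y : ℕ} {T T' U U' : ℕ → ℕ → ℕ}
    (h : IsInsertionAt q T T' r x y) (hT : ∀ c, U r c = T r c) (hT' : ∀ c, U' r c = T' r c)
    (htop : ∀ c, padTop U' r c = padTop T' r c) : IsInsertionAt q U U' r x y := by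
  have hl : ∀ c, padLeft U r c = padLeft T r c := by
    rintro (_ | c)
    · rfl
    · exact hT c
  refine ⟨h.pos, h.le, h.lt, ?_, ?_, ?_, ?_, ?_, ?_⟩
  all_goals intro c
  all_goals simp only [hT, hT', htop, hl]
  exacts [h.next c, h.same_of_le c, h.same_of_lt c, h.replace c, h.fail_left c, h.fail_top c]

theorem isInsertionAt_stop {q r : ℕ} {T : ℕ → ℕ → ℕ} (hT : ∀ r c, T r c ≤ q + 1) :
    IsInsertionAt q T T r (q + 1) (q + 1) := by
  constructor
  · omega
  · omega
  · omega
  · intro c _ h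
    have := hT r c
    omega
  · intros; rfl
  · intros; rfl
  · intro c _ h
    have := hT r c
    omega
  · intros; rfl
  · intros; rfl

theorem IsUpdate.isInsertionAt {q : ℕ} {T C : List (List ℕ)} {i j x : ℕ}
    (h : IsUpdate q T C i j x) (hT : IsLabeling q (entry q T)) (hx : 1 ≤ x ∧ x ≤ q)
    (hj : x < entry q T i j) (hj' : ∀ c < j, entry q T i c ≤ x) :
    IsInsertionAt q (entry q T) (entry q (if IsIncreasing C then C else T)) i x (entry q T i j) := by
  have hC := h.isIncreasing_iff hT hx hj
  have hlt : ∀ c, j < c → x < padLeft (entry q T) i c := by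
    rintro (_ | c) hc
    · omega
    · rcases eq_or_lt_of_le (Nat.le_of_lt_succ hc) with rfl | hc
      · exact hj
      · exact hj.trans_le (hT.cellLT_of_lt_right i hc).le
  have hgt : ∀ c, j ≤ c → x < entry q T i c := by
    intro c hc
    rcases eq_or_lt_of_le hc with rfl | hc
    · exact hj
    · exact hj.trans_le (hT.cellLT_of_lt_right i hc).le
  have hne : ∀ c, c ≠ j → entry q (if IsIncreasing C then C else T) i c = entry q T i c := by
    intro c hc
    split_ifs
    · exact h.entry_eq c hc
    · rfl
  have htop : ∀ c, padTop (entry q (if IsIncreasing C then C else T)) i c =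
      padTop (entry q T) i c := by
    intro c
    rcases i with _ | i
    · rfl
    · simp only [padTop]
      split_ifs
      · simp [entry, h.row_eq i (by omega)]
      · rfl
  refine ⟨hx.1, by omega, .inl hj, ?_, ?_, ?_, ?_, ?_, ?_⟩
  · intro c h1 h2
    rcases lt_trichotomy c j with hc | rfl | hc
    · have := hj' c hc
      omega
    · rfl
    · have := hlt c hc
      omega
  · intro c h1
    refine hne c ?_
    rintro rfl
    omega
  · intro c h1
    refine hne c ?_
    rintro rfl
    rcases c with _ | c
    · simp [padLeft] at h1
    · have := hj' c (by omega)
      simp only [padLeft] at h1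
      omega
  · intro c h1 h2 h3
    rw [htop] at h3
    rcases lt_trichotomy c j with hc | rfl | hc
    · have := hj' c hc
      omega
    · rw [if_pos (hC.mpr ⟨h1, h3⟩)]
      exact h.entry_self
    · have := hlt c hc
      omega
  · intro c h1
    by_cases hc : c = j
    · subst hc
      rw [if_neg]
      rw [hC]
      omega
    · exact hne c hc
  · intro c h1
    rw [htop] at h1
    by_cases hc : c = j
    · subst hc
      rw [if_neg]
      rw [hC]
      omega
    · exact hne c hc

theorem adjoin_spec {q : ℕ} {T : List (List ℕ)} {i x : ℕ} (hT : LabelsIn q T)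
    (hinc : IsIncreasing T) (hi : i ≤ T.length) (hx : 1 ≤ x ∧ x ≤ q)
    (hj : ¬ (row T i).findIdx (fun y => decide (x < y)) < (row T i).length) {C : List (List ℕ)}
    (hC : C = if IsIncreasing (adjoin T i x) then adjoin T i x else T) :
    LabelsIn q C ∧ IsIncreasing C ∧ (∀ r < i, row C r = row T r) ∧
      ∃ ξ : ℕ → ℕ, ξ i = x ∧ ∀ r, i ≤ r →
        IsInsertionAt q (entry q T) (entry q C) r (ξ r) (ξ (r + 1)) := by
  have hinc' := (isIncreasing_iff hT).mp hinc
  have hup := isUpdate_adjoin hT hinc'.1 hx hi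
  -- The box past the end of the row counts as labelled `q + 1`; adjoining replaces this label, and
  -- inserting the bumped `q + 1` further down changes nothing.
  have hentry : entry q T i (row T i).length = q + 1 := entry_of_le le_rfl
  have hat := hup.isInsertionAt hinc'.2 hx (by omega) (fun c hc => by
    rw [entry_of_lt hc]
    have := List.not_of_lt_findIdx (hc.trans_le (not_lt.mp hj))
    simpa using this)
  rw [hentry, ← hC] at hat
  have hrow : ∀ r, r ≠ i → row C r = row T r := by
    intro r hr
    rw [hC]
    split_ifs
    · exact hup.row_eq r hr
    · rfl
  refine ⟨?_, ?_, fun r hr => hrow r (by omega), fun r => if r = i then x else q + 1, if_pos rfl,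
    fun r hr => ?_⟩
  · rw [hC]
    split_ifs
    exacts [hup.labels, hT]
  · rw [hC]
    split_ifs with h
    exacts [h, hinc]
  · rcases eq_or_lt_of_le hr with rfl | hr
    · simpa using hat
    · dsimp only
      rw [if_neg (by omega), if_neg (by omega)]
      refine (isInsertionAt_stop (T := entry q C) fun r c => ?_).congr
        (fun c => by simp [entry, hrow r (by omega)]) (fun _ => rfl) (fun _ => rfl)
      rw [hC]
      split_ifs
      exacts [(hup.labels.entry_le r c).2, (hT.entry_le r c).2]

theorem heckeInsertRow_spec {q : ℕ} (T : List (List ℕ)) (i x : ℕ) (hT : LabelsIn q T)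
    (hinc : IsIncreasing T) (hi : i ≤ T.length) (hx : 1 ≤ x ∧ x ≤ q) :
    LabelsIn q (heckeInsertRow T i x) ∧ IsIncreasing (heckeInsertRow T i x) ∧
      (∀ r < i, row (heckeInsertRow T i x) r = row T r) ∧
      ∃ ξ : ℕ → ℕ, ξ i = x ∧ ∀ r, i ≤ r → IsInsertionAt q (entry q T)
        (entry q (heckeInsertRow T i x)) r (ξ r) (ξ (r + 1)) := by
  induction T, i, x using heckeInsertRow.induct with
  | case1 T i x j hj T₁ ih =>
    have hinc' := (isIncreasing_iff hT).mp hinc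
    have hup : IsUpdate q T T₁ i j x := isUpdate_set hT hinc'.1 hx hj
    have hjx : x < (row T i)[j] := by
      have := List.findIdx_getElem (w := hj)
      simpa using this
    have hj' : ∀ c < j, entry q T i c ≤ x := by
      intro c hc
      rw [entry_of_lt (by omega)]
      have := List.not_of_lt_findIdx hc
      simpa using this
    have hentry : entry q T i j = (row T i)[j] := entry_of_lt hj
    have hat := hup.isInsertionAt hinc'.2 hx (by rw [hentry]; exact hjx) hj'
    rw [hentry] at hat
    have hilt : i < T.length := by
      by_contra hi
      rw [row_of_le (not_lt.mp hi)] at hj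
      simp at hj
    set T₂ := if IsIncreasing T₁ then T₁ else T with hT₂
    have hlen : T.length ≤ T₂.length := by
      rw [hT₂]; split_ifs
      · exact hup.le_length
      · rfl
    have hrow₂ : ∀ r, r ≠ i → row T₂ r = row T r := by
      intro r hr
      rw [hT₂]; split_ifs
      · exact hup.row_eq r hr
      · rfl
    have hrec : heckeInsertRow T i x = heckeInsertRow T₂ (i + 1) (row T i)[j] := by
      rw [heckeInsertRow]
      simp only
      rw [dif_pos hj]
    rw [hrec]
    simp only [dite_eq_ite, ← hT₂] at ih
    obtain ⟨h1, h2, h3, ξ, h4, h5⟩ := ih (by rw [hT₂]; split_ifs; exacts [hup.labels, hT])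
      (by rw [hT₂]; split_ifs with h; exacts [h, hinc]) (by omega)
      (hT i _ (List.getElem_mem hj))
    refine ⟨h1, h2, fun r hr => ?_, Function.update ξ i x, by simp, fun r hr => ?_⟩
    · rw [h3 r (by omega), hrow₂ r (by omega)]
    · rcases eq_or_lt_of_le hr with rfl | hr
      · rw [Function.update_self, Function.update_of_ne (by omega), h4]
        -- The recursive call leaves rows `0, …, i` alone, so row `i` and the row above it are
        -- already final.
        refine hat.congr (fun _ => rfl) (fun c => by simp [entry, h3]) (fun c => ?_)
        rcases i with _ | i
        · rfl
        · simp [padTop, entry, h3 i (by omega)]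
      · rw [Function.update_of_ne (by omega), Function.update_of_ne (by omega)]
        exact (h5 r hr).congr (fun c => by simp [entry, hrow₂ r (by omega)]) (fun _ => rfl)
          (fun _ => rfl)
  | case2 T i x j hj hadj | case3 T i x j hj hadj =>
    have hrec : heckeInsertRow T i x =
        if IsIncreasing (adjoin T i x) then adjoin T i x else T := by
      rw [heckeInsertRow]
      simp only
      rw [dif_neg hj]
    rw [hrec]
    exact adjoin_spec hT hinc hi hx hj rfl

theorem heckeInsert_spec {q : ℕ} {T : List (List ℕ)} {x : ℕ} (hT : LabelsIn q T)
    (hinc : IsIncreasing T) (hx : 1 ≤ x ∧ x ≤ q) :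
    LabelsIn q (heckeInsert T x) ∧ IsIncreasing (heckeInsert T x) ∧
      ∃ ξ : ℕ → ℕ, ξ 0 = x ∧ IsInsertion q (entry q T) (entry q (heckeInsert T x)) ξ := by
  obtain ⟨h1, h2, -, ξ, h3, h4⟩ := heckeInsertRow_spec T 0 x hT hinc (Nat.zero_le _) hx
  refine ⟨h1, h2, ξ, h3, ?_⟩
  exact ⟨fun r => (h4 r r.zero_le).pos, fun r => (h4 r r.zero_le).le,
    fun r => (h4 r r.zero_le).lt, fun r => (h4 r r.zero_le).next,
    fun r => (h4 r r.zero_le).same_of_le, fun r => (h4 r r.zero_le).same_of_lt,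
    fun r => (h4 r r.zero_le).replace, fun r => (h4 r r.zero_le).fail_left,
    fun r => (h4 r r.zero_le).fail_top⟩

/-! ### The insertion tableaux of the prefixes of a word -/

/-- The rows of the insertion tableau of the first `m` letters of `w`. -/
def prefixRows {n : ℕ} (w : Fin n → ℕ) (m : ℕ) : List (List ℕ) :=
  ((List.ofFn w).take m).foldl heckeInsert []

theorem prefixRows_succ {n : ℕ} (w : Fin n → ℕ) {m : ℕ} (h : m < n) :
    prefixRows w (m + 1) = heckeInsert (prefixRows w m) (w ⟨m, h⟩) := by
  unfold prefixRows
  rw [List.take_add_one, List.foldl_append, List.getElem?_eq_getElem (by simpa using h)]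
  simp

theorem prefixRows_self {n : ℕ} (w : Fin n → ℕ) : prefixRows w n = heckeRows w := by
  unfold prefixRows heckeRows
  rw [List.take_of_length_le (by simp)]

theorem labelsIn_nil {q : ℕ} : LabelsIn q [] := by
  intro r a ha
  simp [row] at ha

theorem entry_nil {q : ℕ} (r c : ℕ) : entry q [] r c = q + 1 := by
  simp [entry, row]

theorem isIncreasing_nil : IsIncreasing [] := by
  simp [IsIncreasing]

/-- An insertion uses at most one new column: if the left neighbour is `q + 1`, either the path runs
further left or `fail_left` applies. -/
theorem IsInsertion.eq_of_le {q : ℕ} {T T' : ℕ → ℕ → ℕ} {ξ : ℕ → ℕ} (h : IsInsertion q T T' ξ)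
    {m : ℕ} (hm : ∀ r c, m ≤ c → T r c = q + 1) (r c : ℕ) (hc : m + 1 ≤ c) :
    T' r c = q + 1 := by
  obtain ⟨c, rfl⟩ : ∃ c', c = c' + 1 := ⟨c - 1, by omega⟩
  have f := h.row_facts' r c
  have h1 := hm r c (by omega)
  have h2 := hm r (c + 1) (by omega)
  have h3 := h.le r
  omega

theorem prefixRows_spec {n q : ℕ} {w : Fin n → ℕ} (hw : w ∈ Words n q) {m : ℕ} (hm : m ≤ n) :
    LabelsIn q (prefixRows w m) ∧ IsIncreasing (prefixRows w m) ∧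
      ∀ r c, m ≤ c → entry q (prefixRows w m) r c = q + 1 := by
  induction m with
  | zero =>
    refine ⟨?_, ?_, fun r c _ => ?_⟩
    exacts [labelsIn_nil, isIncreasing_nil, entry_nil r c]
  | succ m ih =>
    obtain ⟨h1, h2, h3⟩ := ih (by omega)
    obtain ⟨h4, h5, ξ, -, h6⟩ := heckeInsert_spec h1 h2 (hw ⟨m, hm⟩)
    rw [prefixRows_succ w hm]
    exact ⟨h4, h5, h6.eq_of_le h3⟩

/-! ### Boards with several bands of rows -/

/-- The labeling `L`, shifted down by `d` rows, below the first `d` rows of `U`. -/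
def stack (d : ℕ) (U L : ℕ → ℕ → ℕ) (r c : ℕ) : ℕ := if r < d then U r c else L (r - d) c

theorem stack_of_lt {d r : ℕ} (U L : ℕ → ℕ → ℕ) (h : r < d) (c : ℕ) : stack d U L r c = U r c :=
  if_pos h

theorem stack_add (d : ℕ) (U L : ℕ → ℕ → ℕ) (r c : ℕ) : stack d U L (d + r) c = L r c := by
  simp [stack]

theorem stack_lt_imp {d r c : ℕ} {U O N : ℕ → ℕ → ℕ} (h : stack d U O r c < stack d U N r c) :
    ∃ s, r = d + s := by
  refine ⟨r - d, ?_⟩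
  by_contra hr
  rw [stack_of_lt _ _ (by omega), stack_of_lt _ _ (by omega)] at h
  exact lt_irrefl _ h

theorem IsSlide.stack {q : ℕ} {O N : ℕ → ℕ → ℕ} (h : IsSlide q O N) (d : ℕ) (U : ℕ → ℕ → ℕ) :
    IsSlide q (stack d U O) (stack d U N) where
  le r c := by
    unfold KTab.stack
    split_ifs
    exacts [le_rfl, h.le _ _]
  le_right r c hc := by
    obtain ⟨r, rfl⟩ := stack_lt_imp hc
    simp only [stack_add] at *
    exact h.le_right r c hc
  le_down r c hc := by
    obtain ⟨r, rfl⟩ := stack_lt_imp hc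
    simp only [stack_add, add_assoc] at *
    exact h.le_down r c hc
  eq r c hc := by
    obtain ⟨r, rfl⟩ := stack_lt_imp hc
    simp only [stack_add, add_assoc] at *
    exact h.eq r c hc
  source r c h0 hq hc := by
    obtain ⟨r, rfl⟩ := stack_lt_imp hc
    simp only [stack_add] at h0 hq hc
    rcases h.source r c h0 hq hc with ⟨c', rfl, h1, h2⟩ | ⟨r, rfl, h1, h2⟩
    · refine .inl ⟨c', rfl, ?_⟩
      simp only [stack_add]
      exact ⟨h1, h2⟩
    · refine .inr ⟨d + r, rfl, ?_⟩
      simp only [stack_add]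
      exact ⟨h1, h2⟩
  push_right r c hc := by
    obtain ⟨r, rfl⟩ := stack_lt_imp hc
    simp only [stack_add] at *
    exact h.push_right r c hc
  push_down r c hc := by
    obtain ⟨r, rfl⟩ := stack_lt_imp hc
    simp only [stack_add, add_assoc] at *
    exact h.push_down r c hc

theorem IsInsertion.slideBoard_start_iff {q : ℕ} {T T' : ℕ → ℕ → ℕ} {ξ : ℕ → ℕ}
    (h : IsInsertion q T T' ξ) (hT : ∀ r c, 0 < T r c) (k r c : ℕ) :
    slideBoard T T' ξ (k + 1) r c = 0 ∧ 0 < slideBoard T T' ξ k r c ↔ r = 0 ∧ c = k := by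
  have hcol : 0 < slideColumn T ξ r c :=
    lt_max_of_lt_right (lt_min (hT r c) (h.pos r))
  constructor
  · rintro ⟨h1, h2⟩
    obtain rfl | rfl := slideBoard_lt_imp (h1 ▸ h2)
    · refine ⟨?_, rfl⟩
      rw [slideBoard_of_lt (by omega)] at h1
      rcases r with _ | r
      · rfl
      · exact absurd h1 (hT r c).ne'
    · rw [slideBoard_self] at h1
      omega
  · rintro ⟨rfl, rfl⟩
    rw [slideBoard_of_lt (by omega), slideBoard_self]
    exact ⟨rfl, hcol⟩

/-- The labeling in which all the labels of the superstandard tableau are underlined and the word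
`w` fills the antidiagonal. -/
def wordLabeling (q : ℕ) {n : ℕ} (w : Fin n → ℕ) (r c : ℕ) : ℕ :=
  if h : r + c + 1 = n then w ⟨c, by omega⟩ else if r + c < n then 0 else q + 1

theorem isLabeling_wordLabeling {n q : ℕ} {w : Fin n → ℕ} (hw : w ∈ Words n q) :
    IsLabeling q (wordLabeling q w) where
  le r c := by
    unfold wordLabeling
    split_ifs with h
    · have := hw ⟨c, by omega⟩
      omega
    all_goals omega
  right r c := by
    unfold wordLabeling CellLT
    split_ifs with h
    any_goals omega
    have := hw ⟨c, by omega⟩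
    omega
  down r c := by
    unfold wordLabeling CellLT
    split_ifs with h
    any_goals omega
    have := hw ⟨c, by omega⟩
    omega

/-- This rereads the finished board as the start of the next row. Column `m` of `T` is empty, so its
slide column is the letter `ξ 0` on top of empty boxes. -/
theorem stack_succ_wordLabeling {n q : ℕ} {w : Fin n → ℕ} (hw : w ∈ Words n q)
    {T T' : ℕ → ℕ → ℕ} {ξ : ℕ → ℕ} {d m : ℕ} (hd : d + m + 1 = n) (hξ : ξ 0 = w ⟨m, by omega⟩)
    (hle : ∀ r c, T r c ≤ q + 1)
    (hT : ∀ r c, m ≤ c → T r c = q + 1) (hT' : ∀ r c, m + 1 ≤ c → T' r c = q + 1)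
    (hξ' : ∀ r, ξ r ≤ q + 1) :
    stack (d + 1) (wordLabeling q w) T = stack d (wordLabeling q w) (slideBoard T T' ξ m) := by
  funext r c
  rcases lt_or_ge r d with hr | hr
  · rw [stack_of_lt _ _ hr, stack_of_lt _ _ (by omega)]
  obtain ⟨r, rfl⟩ := Nat.exists_eq_add_of_le hr
  rw [stack_add]
  rcases r with _ | r
  · rw [stack_of_lt _ _ (by omega)]
    rcases lt_trichotomy c m with hc | rfl | hc
    · rw [slideBoard_of_lt hc, wordLabeling, dif_neg (by omega), if_pos (by omega)]
      rfl
    · rw [slideBoard_self, wordLabeling, dif_pos (by omega)]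
      have h1 := hw ⟨c, by omega⟩
      have h2 := hT 0 c le_rfl
      simp only [slideColumn, padTop]
      omega
    · rw [slideBoard_of_gt hc, wordLabeling, dif_neg (by omega), if_neg (by omega), hT' 0 c hc]
  · rw [show d + (r + 1) = d + 1 + r by omega, stack_add]
    rcases lt_trichotomy c m with hc | rfl | hc
    · rw [slideBoard_of_lt hc]
      rfl
    · rw [slideBoard_self]
      have h1 := hT r c le_rfl
      have h2 := hle (r + 1) c
      have h3 := hξ' (r + 1)
      simp only [slideColumn, padTop]
      omega
    · rw [slideBoard_of_gt hc, hT' (r + 1) c hc, hT r c hc.le]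

/-! ### The superstandard tableau -/

/-- The number of boxes in the first `r` rows of the staircase with rows `m, m - 1, …`. -/
def staircaseOffset (m r : ℕ) : ℕ := ∑ k ∈ Finset.range r, (m - k)

theorem staircaseOffset_succ (m r : ℕ) :
    staircaseOffset m (r + 1) = staircaseOffset m r + (m - r) :=
  Finset.sum_range_succ _ _

theorem staircaseOffset_mono (m : ℕ) : Monotone (staircaseOffset m) :=
  monotone_nat_of_le_succ fun r => by rw [staircaseOffset_succ]; omega

theorem rowLen_staircase (m r : ℕ) : (staircase m).rowLen r = m - r := by
  have h : ∀ c, c < (staircase m).rowLen r ↔ c < m - r := fun c => by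
    rw [← YoungDiagram.mem_iff_lt_rowLen, mem_staircase]
    dsimp only
    omega
  have h1 := h (m - r)
  have h2 := h ((staircase m).rowLen r)
  omega

theorem superstandard_staircase_eq_some {m r c i : ℕ} :
    superstandard (staircase m) (r, c) = some i ↔ r + c < m ∧ staircaseOffset m r + c + 1 = i := by
  unfold superstandard staircaseOffset
  simp only [mem_staircase, rowLen_staircase]
  split_ifs with h
  · simp [h]
  · simp [h]

theorem superstandard_staircase_eq_some_iff {m d k r c : ℕ} (h : d + k < m) :
    superstandard (staircase m) (r, c) = some (staircaseOffset m d + k + 1) ↔ r = d ∧ c = k := by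
  rw [superstandard_staircase_eq_some]
  constructor
  · rintro ⟨h1, h2⟩
    rcases lt_trichotomy r d with hr | rfl | hr
    · have h3 := staircaseOffset_mono m (Nat.succ_le_of_lt hr)
      rw [Nat.succ_eq_add_one, staircaseOffset_succ] at h3
      omega
    · omega
    · have h3 := staircaseOffset_mono m (Nat.succ_le_of_lt hr)
      rw [Nat.succ_eq_add_one, staircaseOffset_succ] at h3
      omega
  · rintro ⟨rfl, rfl⟩
    exact ⟨h, rfl⟩

theorem maxEntry_superstandard_staircase (n : ℕ) :
    maxEntry (superstandard (staircase (n - 1))) = staircaseOffset (n - 1) n := by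
  unfold maxEntry
  simp only [Prod.exists, superstandard_staircase_eq_some]
  -- For `n < 2` the tableau is empty and the supremum of the empty set is 0. Otherwise the maximum
  -- lies in the last box `(n - 2, 0)`; the row with index `n - 1` contributes nothing to the
  -- offset.
  rcases lt_or_ge n 2 with hn | hn
  · have h0 : {a | ∃ r c, r + c < n - 1 ∧ staircaseOffset (n - 1) r + c + 1 = a} = ∅ := by
      ext a
      simp only [Set.mem_ofPred_eq, Set.mem_empty_iff_false, iff_false]
      rintro ⟨r, c, h, -⟩
      omega
    rw [h0]
    interval_cases n <;> simp [staircaseOffset]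
  · refine IsGreatest.csSup_eq ⟨⟨n - 2, 0, by omega, ?_⟩, ?_⟩
    · obtain ⟨n, rfl⟩ := Nat.exists_eq_add_of_le' hn
      rw [staircaseOffset_succ, staircaseOffset_succ]
      simp only [Nat.add_sub_cancel]
      omega
    · rintro a ⟨r, c, h, rfl⟩
      have h3 := staircaseOffset_mono (n - 1) (show r + 1 ≤ n by omega)
      rw [staircaseOffset_succ] at h3
      omega

/-! ### The `K`-infusion -/

theorem wordTableau_eq_some {n : ℕ} {w : Fin n → ℕ} {r c u : ℕ} :
    wordTableau w (r, c) = some u ↔ ∃ h : r + c + 1 = n, w ⟨c, by omega⟩ = u := by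
  unfold wordTableau
  simp only [mem_staircase]
  constructor
  · intro h
    split_ifs at h with h1
    exact ⟨by omega, by simpa using h⟩
  · rintro ⟨h, rfl⟩
    rw [dif_pos (by omega)]

/-- The switches only run up to the largest letter that occurs, so this number takes the place of
`q` in the whole argument. -/
theorem mem_words_maxEntry {n q : ℕ} {w : Fin n → ℕ} (hw : w ∈ Words n q) :
    w ∈ Words n (maxEntry (wordTableau w)) := by
  refine fun k => ⟨(hw k).1, le_csSup ⟨q, ?_⟩ ⟨(n - 1 - k, k), ?_⟩⟩
  · rintro a ⟨⟨r, c⟩, h⟩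
    obtain ⟨h1, rfl⟩ := wordTableau_eq_some.mp h
    exact (hw _).2
  · exact wordTableau_eq_some.mpr ⟨by omega, rfl⟩

theorem represents_overlay {n q : ℕ} {w : Fin n → ℕ} (hw : w ∈ Words n q) (p : ℕ) :
    Represents q (superstandard (staircase (n - 1))) p (wordLabeling q w)
      (overlay (superstandard (staircase (n - 1))) (wordTableau w)) := by
  have hS : ∀ r c, superstandard (staircase (n - 1)) (r, c) = none ↔ n ≤ r + c + 1 := by
    intro r c
    unfold superstandard
    simp only [mem_staircase]
    split_ifs with h
    · simp
      omega
    · simp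
      omega
  have hunder : ∀ r c i, overlay (superstandard (staircase (n - 1))) (wordTableau w) (r, c) =
      some (.inl i) ↔ superstandard (staircase (n - 1)) (r, c) = some i := by
    intro r c i
    unfold overlay
    split
    · next a h => simp [h]
    · next h => simp [h]
  have hplain : ∀ r c u, overlay (superstandard (staircase (n - 1))) (wordTableau w) (r, c) =
      some (.inr u) ↔ wordTableau w (r, c) = some u := by
    intro r c u
    unfold overlay
    split
    · next a h =>
      simp only [Option.some.injEq, reduceCtorEq, false_iff]
      intro h1
      obtain ⟨h2, -⟩ := wordTableau_eq_some.mp h1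
      rw [(hS r c).mpr (by omega)] at h
      simp at h
    · simp
  refine ⟨isLabeling_wordLabeling hw, ?_, fun r c u => ?_, fun i _ r c => hunder r c i⟩
  · rintro ⟨r, c⟩ ⟨r', c'⟩ hne hrc (i | u) h1 h2
    · rw [hunder, superstandard_staircase_eq_some] at h1 h2
      refine hne ?_
      obtain ⟨h1, rfl⟩ := h1
      have := (superstandard_staircase_eq_some_iff h1).mp
        (superstandard_staircase_eq_some.mpr h2)
      rw [this.1, this.2]
    · rw [hplain, wordTableau_eq_some] at h1 h2
      obtain ⟨h1, -⟩ := h1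
      obtain ⟨h2, -⟩ := h2
      simp only [ne_eq, Prod.mk.injEq] at hne hrc
      omega
  · rw [hplain, wordTableau_eq_some]
    unfold wordLabeling
    split_ifs with h h'
    · have := hw ⟨c, by omega⟩
      simp only [h, exists_true_left]
      omega
    · simp only [h, IsEmpty.exists_iff, false_iff]
      omega
    · simp only [h, IsEmpty.exists_iff, false_iff]
      omega

/-- The slides of the underlined labels `p, p - 1, …, 1`. -/
noncomputable def slides (q p : ℕ) (M : Option MixedFilling) : Option MixedFilling :=
  (List.range' 1 p).reverse.foldl (fun M i => slide q i M) M

theorem slides_succ (q p : ℕ) (M : Option MixedFilling) :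
    slides q (p + 1) M = slides q p (slide q (p + 1) M) := by
  unfold slides
  rw [List.range'_1_concat, List.reverse_append, List.foldl_append, add_comm 1 p]
  rfl

theorem switchAll_eq_slides (A B : Filling) :
    switchAll A B = slides (maxEntry B) (maxEntry A) (some (overlay A B)) := by
  unfold switchAll standardSwitchSequence slides slide
  rw [List.foldl_flatMap]
  simp only [List.foldl_map]

/-- The underlined label `staircaseOffset n d + k + 1` starts in column `k` of row `d`; decreasing
labels therefore run through the row from right to left, each taking the board from `k + 1` to `k`.
-/
theorem exists_slides_row {n q d m : ℕ} {U T T' : ℕ → ℕ → ℕ} {ξ : ℕ → ℕ}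
    (hd : d + m = n) (h : IsInsertion q T T' ξ) (hT : IsLabeling q T) (hT' : IsLabeling q T')
    (hpos : ∀ r c, 0 < T r c) {k : ℕ} (hk : k ≤ m) {M : MixedFilling}
    (hM : Represents q (superstandard (staircase n)) (staircaseOffset n d + k)
      (stack d U (slideBoard T T' ξ k)) M) :
    ∃ M', slides q (staircaseOffset n d + k) (some M) = slides q (staircaseOffset n d) (some M') ∧
      Represents q (superstandard (staircase n)) (staircaseOffset n d) (stack d U T') M' := by
  induction k generalizing M with
  | zero => exact ⟨M, rfl, by rwa [h.slideBoard_zero hT] at hM⟩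
  | succ k ih =>
    rw [← add_assoc] at hM
    obtain ⟨M₁, h1, h2⟩ := hM.exists_slide ((h.isSlide_slideBoard hT hT' k).stack d U) (by
      intro r c
      rw [superstandard_staircase_eq_some_iff (by omega)]
      rcases lt_or_ge r d with hr | hr
      · rw [stack_of_lt _ _ hr, stack_of_lt _ _ hr]
        omega
      · obtain ⟨r, rfl⟩ := Nat.exists_eq_add_of_le hr
        rw [stack_add, stack_add, h.slideBoard_start_iff hpos]
        omega)
    obtain ⟨M', h3, h4⟩ := ih (by omega) h2
    exact ⟨M', by rw [← add_assoc, slides_succ, h1, h3], h4⟩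

theorem exists_slides {n q : ℕ} {w : Fin n → ℕ} (hw : w ∈ Words n q) {d : ℕ} (hd : d ≤ n)
    {M : MixedFilling}
    (hM : Represents q (superstandard (staircase (n - 1))) (staircaseOffset (n - 1) d)
      (stack d (wordLabeling q w) (entry q (prefixRows w (n - d)))) M) :
    ∃ M', slides q (staircaseOffset (n - 1) d) (some M) = some M' ∧
      Represents q (superstandard (staircase (n - 1))) 0 (entry q (prefixRows w n)) M' := by
  induction d generalizing M with
  | zero => exact ⟨M, rfl, hM⟩
  | succ d ih =>
    -- Row `d` has `m = n - 1 - d` underlined boxes, and its antidiagonal box carries the letter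
    -- with index `m`, which is the next one to be inserted.
    obtain ⟨m, hm⟩ := Nat.exists_eq_add_of_le hd
    have hmn : m < n := by omega
    obtain ⟨h1, h2, h3⟩ := prefixRows_spec hw hmn.le
    obtain ⟨h1', h2', h3'⟩ := prefixRows_spec hw (show m + 1 ≤ n from hmn)
    obtain ⟨-, -, ξ, h6, h7⟩ := heckeInsert_spec h1 h2 (hw ⟨m, hmn⟩)
    rw [← prefixRows_succ w hmn] at h7
    rw [show n - (d + 1) = m by omega, stack_succ_wordLabeling hw (by omega) h6
      (fun r c => (h1.entry_le r c).2) h3 h3' h7.le, staircaseOffset_succ,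
      show n - 1 - d = m by omega] at hM
    obtain ⟨M₁, h8, h9⟩ := exists_slides_row (by omega) h7 ((isIncreasing_iff h1).mp h2).2
      ((isIncreasing_iff h1').mp h2').2 (fun r c => (h1.entry_le r c).1) le_rfl hM
    rw [show m + 1 = n - d by omega] at h9
    obtain ⟨M', h10, h11⟩ := ih (by omega) h9
    refine ⟨M', ?_, h11⟩
    rw [staircaseOffset_succ, show n - 1 - d = m by omega, h8, h10]

theorem ofRows_eq_some {q : ℕ} {T : List (List ℕ)} (hT : LabelsIn q T) {r c u : ℕ} :
    ofRows T (r, c) = some u ↔ 1 ≤ u ∧ u ≤ q ∧ entry q T r c = u := by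
  unfold ofRows
  dsimp only
  rcases lt_or_ge c (row T r).length with h | h
  · have := hT.entry_mem h
    rw [List.getElem?_eq_getElem h, ← entry_of_lt (q := q) h, Option.some.injEq]
    omega
  · rw [List.getElem?_eq_none h, entry_of_le h]
    simp only [reduceCtorEq, false_iff]
    omega

theorem Represents.plainPart_eq {q p : ℕ} {S : Filling} {T : List (List ℕ)} {M : MixedFilling}
    (hM : Represents q S p (entry q T) M) (hT : LabelsIn q T) : plainPart M = ofRows T := by
  funext ⟨r, c⟩
  ext u
  rw [ofRows_eq_some hT, ← hM.plain]
  simp [plainPart, Option.bind_eq_some_iff, Sum.getRight?_eq_some_iff]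

end KTab

theorem theorem4p2 (n q : ℕ) (w : Fin n → ℕ) (hw : w ∈ KTab.Words n q) :
    KTab.kInfusion₁ (KTab.superstandard (KTab.staircase (n - 1))) (KTab.wordTableau w) =
      some (KTab.heckeTableau w) := by
  have hw' := KTab.mem_words_maxEntry hw
  have hM := KTab.represents_overlay hw' (KTab.staircaseOffset (n - 1) n)
  -- At the start no letter has been inserted: the board is the stack with the tableau of the empty
  -- prefix below all `n` rows.
  have hstack : KTab.stack n (KTab.wordLabeling (KTab.maxEntry (KTab.wordTableau w)) w)
      (KTab.entry (KTab.maxEntry (KTab.wordTableau w)) (KTab.prefixRows w (n - n))) =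
      KTab.wordLabeling (KTab.maxEntry (KTab.wordTableau w)) w := by
    funext r c
    rw [Nat.sub_self]
    unfold KTab.stack
    split_ifs with h
    · rfl
    · rw [KTab.wordLabeling, dif_neg (by omega), if_neg (by omega)]
      exact KTab.entry_nil _ _
  rw [← hstack] at hM
  obtain ⟨M', h1, h2⟩ := KTab.exists_slides hw' le_rfl hM
  unfold KTab.kInfusion₁
  rw [KTab.switchAll_eq_slides, KTab.maxEntry_superstandard_staircase, h1, Option.map_some,
    h2.plainPart_eq (KTab.prefixRows_spec hw' le_rfl).1, KTab.prefixRows_self]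
  rfl
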